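/- Let $C\subseteq\mathbb F_3^n$ be a ternary $1$-perfect code, i.e. a set of pairwise non-adjacent vertices of the Hamming graph $H(n,3)$ (two words of $\mathbb F_3^n$ are adjacent if they differ in exactly one coordinate) such that every word outside $C$ is adjacent to exactly one word of $C$. Suppose that $C$ has rank $+1$, i.e. $n=(3^m-1)/2$ for an integer $m\ge 1$ and the affine span of $C$ has dimension $n-m+1$. Let $\ker(C)=\{x\in\mathbb F_3^n : x+C=C\}$ be the kernel of $C$, which is a linear subspace of $\mathbb F_3^n$. Then $$\dim\ker(C)\ \ge\ \frac{n-1}{3}.$$ Moreover, there is a monomial transformation $\psi$ of $\mathbb F_3^n$ (a permutation of the coordinates followed by multiplication of each coordinate by a nonzero scalar) such that $\ker(\psi(C))$ contains the $(n-1)/3$ vectors $$(1,1,1,0,\ldots,0),\quad (0,0,0,1,1,1,0,\ldots,0),\quad\ldots,\quad (0,\ldots,0,1,1,1,0).$$ -/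

import Mathlib

open scoped Pointwise

namespace TernaryPerfect

/-- The space of ternary words of length `n`. -/
abbrev Word (n : ℕ) : Type := Fin n → ZMod 3

/-- The Hamming graph `H(n, 3)`: two words are adjacent if they differ in exactly one position. -/
def hammingGraph (n : ℕ) : SimpleGraph (Word n) where
  Adj x y := hammingDist x y = 1
  symm.symm x y h := by rw [hammingDist_comm]; exact h
  loopless.irrefl x h := by simp at h

/-- A 1-perfect code: an independent set of vertices of `H(n, 3)` such that every non-code vertex
is adjacent to exactly one codeword. -/
def IsOnePerfect {n : ℕ} (C : Set (Word n)) : Prop :=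
  (hammingGraph n).IsIndepSet C ∧
    ∀ x : Word n, x ∉ C → ∃! c : Word n, c ∈ C ∧ (hammingGraph n).Adj x c

/-- The rank of a code: the dimension of its affine span. -/
noncomputable def codeRank {n : ℕ} (C : Set (Word n)) : ℕ :=
  Module.finrank (ZMod 3) (affineSpan (ZMod 3) C).direction

/-- The code `C` of length `n = (3 ^ m - 1) / 2`, `m ≥ 1`, is of rank `+r`: its rank is
`n - m + r`. (The equation is written without subtraction; `3 ^ m - 1` is even.) -/
def HasRankPlus {n : ℕ} (C : Set (Word n)) (r : ℕ) : Prop :=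
  ∃ m : ℕ, 1 ≤ m ∧ n = (3 ^ m - 1) / 2 ∧ codeRank C + m = n + r

/-- The kernel of a code `C`: the set of all `x` with `x + C = C`. It is a subspace, since the
field has three elements. -/
def codeKernel {n : ℕ} (C : Set (Word n)) : Submodule (ZMod 3) (Word n) where
  carrier := {x | x +ᵥ C = C}
  zero_mem' := zero_vadd _ C
  add_mem' {x y} hx hy := by
    simp only [Set.mem_ofPred_eq] at hx hy ⊢
    rw [add_vadd, hy, hx]
  smul_mem' a x hx := by
    exact (AddSubgroup.toZModSubmodule 3
      (AddAction.stabilizer (Word n) C)).smul_mem a hx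

/-- The monomial transformation that moves the symbol in position `i` to position `π i` and
multiplies the symbol in each position `i` of the result by the nonzero scalar `ε i`. -/
def monomialMap {n : ℕ} (π : Equiv.Perm (Fin n)) (ε : Fin n → (ZMod 3)ˣ) (x : Word n) : Word n :=
  fun i => (ε i : ZMod 3) * x (π.symm i)

/-- The word with `(1, 1, 1)` in the positions `3j, 3j + 1, 3j + 2` (counted from `0`) and zeros
elsewhere. -/
def tripleWord (n j : ℕ) : Word n :=
  fun i => if (i : ℕ) / 3 = j then 1 else 0

end TernaryPerfect

/-! Let `A` be the affine span of `C`, and take syndromes modulo its direction. The radius-one balls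
around codewords tile the space, and rank `+1` makes each syndrome that of exactly three words of
weight at most one (`card_errorWord_syndrome`). For syndrome zero this gives a single position `i₀`
with zero column; the other positions fall into triples whose columns agree up to sign
(`exists_triples`). Each `w ∈ A` decodes by a change `F w` at `i₀` alone. If `E 0`, `E 1`, `E 2` are
signed unit words on a triple, a step `w ↦ w + E a - E b` with `a ≠ b` must change `F`, since
codewords are never at distance two. Hence `c`, `c + E 0 - E 1`, `c + E 1 - E 0` use all three
values of `F`. The word `c + E 0 + E 1 + E 2` is one step from each of the last two, so it shares
the value `F c = 0` and is a codeword (`add_mem_of_three`). -/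

namespace TernaryPerfect

/-! ### Unique decoding of errors of weight at most one. -/

/-- The words of weight at most one, parametrized by the zero word (`none`) and the pairs of a
position and a nonzero symbol. -/
def errorWord {n : ℕ} : Option (Fin n × (ZMod 3)ˣ) → Word n
  | none => 0
  | some p => Pi.single p.1 (p.2 : ZMod 3)

lemma hammingDist_eq_one_iff {n : ℕ} {x y : Word n} :
    hammingDist x y = 1 ↔ ∃ p : Fin n × (ZMod 3)ˣ, y + errorWord (some p) = x := by
  constructor
  · intro h
    obtain ⟨i, hi⟩ := Finset.card_eq_one.1 h
    have hne : x i - y i ≠ 0 := by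
      have : i ∈ ({i} : Finset (Fin n)) := by simp
      rw [← hi] at this
      simpa [sub_eq_zero] using this
    refine ⟨(i, Units.mk0 _ hne), ?_⟩
    funext j
    by_cases hj : j = i
    · subst hj
      simp [errorWord]
    · have : j ∉ ({i} : Finset (Fin n)) := by simpa using hj
      rw [← hi] at this
      have hxy : x j = y j := by simpa using this
      simp [errorWord, hj, hxy]
  · rintro ⟨⟨i, u⟩, rfl⟩
    refine Finset.card_eq_one.2 ⟨i, ?_⟩
    ext j
    by_cases hj : j = i
    · subst hj
      simp [errorWord]
    · simp [errorWord, hj]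

lemma errorWord_injective {n : ℕ} : Function.Injective (errorWord (n := n)) := by
  rintro (_ | ⟨i, u⟩) (_ | ⟨j, v⟩) h
  · rfl
  · have := congrFun h j
    simp [errorWord] at this
    exact absurd this.symm v.ne_zero
  · have := congrFun h i
    simp [errorWord] at this
  · have hij : i = j := by
      by_contra hij
      have := congrFun h i
      simp [errorWord, hij] at this
    subst hij
    have := congrFun h i
    simp only [errorWord, Pi.single_eq_same] at this
    rw [Units.ext this]

/-- The radius-one balls around codewords tile the space. -/
lemma IsOnePerfect.bijective {n : ℕ} {C : Set (Word n)} (hC : IsOnePerfect C) :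
    Function.Bijective
      (fun p : C × Option (Fin n × (ZMod 3)ˣ) => (p.1 : Word n) + errorWord p.2) := by
  have key : ∀ (c d : Word n) (a b : Option (Fin n × (ZMod 3)ˣ)), c ∈ C → d ∈ C →
      c + errorWord a = d + errorWord b → c = d := by
    intro c d a b hc hd h
    have indep : ∀ c d : Word n, ∀ p : Fin n × (ZMod 3)ˣ, c ∈ C → d ∈ C →
        c ≠ d + errorWord (some p) := by
      intro c d p hc hd h
      have h1 : hammingDist c d = 1 := hammingDist_eq_one_iff.2 ⟨p, h.symm⟩
      refine hC.1 hc hd ?_ h1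
      rintro rfl
      simp at h1
    by_cases hx : c + errorWord a ∈ C
    · rcases a with _ | p
      · rcases b with _ | q
        · simpa [errorWord] using h
        · exact absurd (by simpa [errorWord] using h) (indep c d q hc hd)
      · exact absurd rfl (indep _ c p hx hc)
    · obtain ⟨e, -, he⟩ := hC.2 _ hx
      rcases a with _ | p
      · exact absurd (by simpa [errorWord] using hc) hx
      rcases b with _ | q
      · exact absurd (by rw [h]; simpa [errorWord] using hd) hx
      rw [he c ⟨hc, hammingDist_eq_one_iff.2 ⟨p, rfl⟩⟩,
        he d ⟨hd, hammingDist_eq_one_iff.2 ⟨q, h.symm⟩⟩]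
  constructor
  · rintro ⟨⟨c, hc⟩, a⟩ ⟨⟨d, hd⟩, b⟩ h
    obtain rfl := key c d a b hc hd h
    exact Prod.ext rfl (errorWord_injective (add_left_cancel h))
  · intro x
    by_cases hx : x ∈ C
    · exact ⟨(⟨x, hx⟩, none), by simp [errorWord]⟩
    · obtain ⟨c, ⟨hc, hxc⟩, -⟩ := hC.2 x hx
      obtain ⟨p, hp⟩ := hammingDist_eq_one_iff.1 hxc
      exact ⟨(⟨c, hc⟩, some p), hp⟩

/-- Two codewords of a 1-perfect code are not at distance two. -/
lemma IsOnePerfect.not_mem_add_sub {n : ℕ} {C : Set (Word n)} (hC : IsOnePerfect C)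
    {p q : Fin n × (ZMod 3)ˣ} (hpq : p ≠ q) {c : Word n} (hc : c ∈ C) :
    c + errorWord (some p) - errorWord (some q) ∉ C := by
  intro hd
  have := @hC.bijective.1 (⟨c, hc⟩, some p) (⟨_, hd⟩, some q) (by simp)
  simp only [Prod.mk.injEq, Option.some.injEq] at this
  exact hpq this.2

/-! ### Counting errors by syndrome. -/

/-- All codewords have syndrome `s`, so the tiling restricts to the words of syndrome `s + v`, whose
errors are exactly those of syndrome `v`. -/
lemma card_fiber {n : ℕ} {V : Type*} [AddCommGroup V] {C : Set (Word n)} (hC : IsOnePerfect C)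
    (H : Word n →+ V) {s : V} (hs : ∀ c ∈ C, H c = s) (v : V) :
    Nat.card C * Nat.card {b : Option (Fin n × (ZMod 3)ˣ) // H (errorWord b) = v} =
      Nat.card {w : Word n // H w = s + v} := by
  rw [← Nat.card_prod]
  refine Nat.card_congr (Equiv.ofBijective
    (fun p => ⟨(p.1 : Word n) + errorWord p.2.1, ?_⟩) ⟨?_, ?_⟩)
  · rw [map_add, hs _ p.1.2, p.2.2]
  · rintro ⟨c, a, ha⟩ ⟨d, b, hb⟩ h
    have := @hC.bijective.1 (c, a) (d, b) (congrArg Subtype.val h)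
    simp only [Prod.mk.injEq] at this
    obtain ⟨rfl, rfl⟩ := this
    rfl
  · rintro ⟨w, hw⟩
    obtain ⟨⟨c, a⟩, h⟩ := hC.bijective.2 w
    refine ⟨⟨c, a, ?_⟩, Subtype.ext h⟩
    rw [← h] at hw
    simpa [hs _ c.2] using hw

lemma IsOnePerfect.card_mul {n : ℕ} {C : Set (Word n)} (hC : IsOnePerfect C) :
    Nat.card C * (2 * n + 1) = 3 ^ n := by
  have h := Nat.card_congr (Equiv.ofBijective _ hC.bijective)
  rw [Nat.card_prod] at h
  have hu : Fintype.card (ZMod 3)ˣ = 2 := by decide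
  simpa [hu, mul_comm n 2] using h

lemma two_mul_add_one_of_eq {n m : ℕ} (h : n = (3 ^ m - 1) / 2) : 2 * n + 1 = 3 ^ m := by
  have h1 : (3 : ℕ) ^ m % 2 = 1 := Nat.odd_iff.1 (Odd.pow (by decide))
  generalize 3 ^ m = x at *
  omega

/-- For a 1-perfect code of rank `+1`, every syndrome with respect to the affine span is the
syndrome of exactly three words of weight at most one. -/
lemma card_errorWord_syndrome {n : ℕ} {C : Set (Word n)} (hC : IsOnePerfect C)
    (hr : HasRankPlus C 1) (v : Word n ⧸ (affineSpan (ZMod 3) C).direction) :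
    Nat.card {b : Option (Fin n × (ZMod 3)ˣ) //
      (affineSpan (ZMod 3) C).direction.mkQ (errorWord b) = v} = 3 := by
  obtain ⟨m, -, hn, hrank⟩ := hr
  have hcard := hC.card_mul
  rw [two_mul_add_one_of_eq hn] at hcard
  have hpos : 0 < Nat.card C := by
    rcases Nat.eq_zero_or_pos (Nat.card C) with h | h
    · rw [h, zero_mul] at hcard
      exact absurd hcard.symm (by positivity)
    · exact h
  obtain ⟨⟨c₀, hc₀⟩⟩ := (Nat.card_pos_iff.1 hpos).1
  revert v
  set W := (affineSpan (ZMod 3) C).direction with hW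
  intro v
  have hs : ∀ c ∈ C, W.mkQ.toAddMonoidHom c = W.mkQ c₀ := by
    intro c hc
    refine (Submodule.Quotient.eq W).2 ?_
    exact AffineSubspace.vsub_mem_direction (subset_affineSpan _ _ hc)
      (subset_affineSpan _ _ hc₀)
  have h := card_fiber hC W.mkQ.toAddMonoidHom hs v
  have hfib : Nat.card {w : Word n // W.mkQ.toAddMonoidHom w = W.mkQ c₀ + v} = Nat.card W := by
    obtain ⟨z, hz⟩ := W.mkQ_surjective (W.mkQ c₀ + v)
    rw [← hz]
    refine Nat.card_congr ((Equiv.addRight (-z)).subtypeEquiv fun w => ?_)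
    change W.mkQ w = W.mkQ z ↔ w + -z ∈ W
    rw [← sub_eq_add_neg]
    exact Submodule.Quotient.eq W
  have hWcard : Nat.card W = 3 ^ codeRank C := by
    rw [Module.natCard_eq_pow_finrank (K := ZMod 3), Nat.card_zmod]
    rfl
  rw [hfib, hWcard] at h
  -- Rank `+1` means that the direction has three times as many elements as `C`.
  have h3 : 3 ^ codeRank C * 3 ^ m = (Nat.card C * 3 ^ m) * 3 := by
    rw [hcard, ← pow_add, hrank, pow_succ]
  have h4 : Nat.card C * 3 = 3 ^ codeRank C := by
    have : (0 : ℕ) < 3 ^ m := by positivity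
    apply Nat.eq_of_mul_eq_mul_right this
    rw [h3]; ring
  rw [← h4] at h
  exact Nat.eq_of_mul_eq_mul_left hpos h

/-! ### Periods of the code from three equal syndromes. -/

/-- If every word of an affine space `A` containing `C` can be moved into `C` by changing position
`i₀`, then the sum of three words of
weight one with distinct supports and equal syndromes is a period of `C`. -/
lemma add_mem_of_three {n : ℕ} {C : Set (Word n)} (hC : IsOnePerfect C)
    {A : AffineSubspace (ZMod 3) (Word n)} (hA : C ⊆ A) {i₀ : Fin n}
    (he : ∀ w ∈ A, ∃ y : ZMod 3, w + Pi.single i₀ y ∈ C)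
    {p : Fin 3 → Fin n × (ZMod 3)ˣ} (hp : Function.Injective p)
    (hdir : ∀ a b, errorWord (some (p a)) - errorWord (some (p b)) ∈ A.direction)
    {c : Word n} (hc : c ∈ C) :
    c + ∑ a, errorWord (some (p a)) ∈ C := by
  have hA' : ∀ w ∈ A, ∀ a b, w + errorWord (some (p a)) - errorWord (some (p b)) ∈ A := by
    intro w hw a b
    have := AffineSubspace.vadd_mem_of_mem_direction (hdir a b) hw
    rw [vadd_eq_add] at this
    convert this using 1
    abel
  choose! F hF using he
  have hFne : ∀ w ∈ A, ∀ a b, a ≠ b →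
      F (w + errorWord (some (p a)) - errorWord (some (p b))) ≠ F w := by
    intro w hw a b hab h
    have h2 := hF _ (hA' w hw a b)
    rw [h] at h2
    refine hC.not_mem_add_sub (hp.ne hab) (hF w hw) ?_
    convert h2 using 1
    abel
  generalize hE : (fun a => errorWord (some (p a)) : Fin 3 → Word n) = E at *
  replace hE : ∀ a, errorWord (some (p a)) = E a := fun a => congrFun hE a
  simp only [hE] at hA' hFne ⊢
  have three : ∀ x : Word n, (3 : ℕ) • x = 0 := fun x => by
    funext i
    simpa using Or.inl (by decide : (3 : ZMod 3) = 0)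
  have hcA := hA hc
  have h1 := hA' c hcA 0 1
  have h2 := hA' c hcA 1 0
  -- In characteristic three, repeating the step from `E 1` to `E 0` gives the opposite step, which
  -- closes the triangle.
  have e12 : c + E 0 - E 1 + E 0 - E 1 = c + E 1 - E 0 := by
    have := congrArg₂ (· - ·) (three (E 0)) (three (E 1))
    simp only [sub_zero] at this
    rw [← sub_eq_zero, ← this]
    abel
  have e13 : c + E 0 - E 1 + E 2 - E 1 = c + ∑ a, E a := by
    rw [Fin.sum_univ_three, ← sub_eq_zero, ← neg_eq_zero, ← three (E 1)]
    abel
  have e23 : c + E 1 - E 0 + E 2 - E 0 = c + ∑ a, E a := by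
    rw [Fin.sum_univ_three, ← sub_eq_zero, ← neg_eq_zero, ← three (E 0)]
    abel
  have n1 := hFne c hcA 0 1 (by decide)
  have n2 := hFne c hcA 1 0 (by decide)
  have n3 := hFne _ h1 0 1 (by decide)
  have n4 := hFne _ h1 2 1 (by decide)
  have n5 := hFne _ h2 2 0 (by decide)
  rw [e12] at n3
  rw [e13] at n4
  rw [e23] at n5
  have ht : c + ∑ a, E a ∈ A := e13 ▸ hA' _ h1 2 1
  -- `F` is an arbitrary choice, but a nonzero value here would put two codewords at distance one.
  have hFc : F c = 0 := by
    by_contra h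
    have := @hC.bijective.1 (⟨c, hc⟩, some (i₀, Units.mk0 _ h)) (⟨_, hF c hcA⟩, none)
      (by simp [errorWord])
    simp at this
  have pigeon : ∀ a b x y : ZMod 3, x ≠ a → y ≠ a → y ≠ x → b ≠ x → b ≠ y → b = a := by
    unfold ZMod
    decide
  have := pigeon _ _ _ _ n1 n2 n3 n4 n5
  have hmem := hF _ ht
  rwa [this, hFc, Pi.single_zero, add_zero] at hmem

/-- One inclusion suffices: translation by `t` has order dividing three, so its inverse is its
square. -/
lemma mem_codeKernel_of_forall {n : ℕ} {C : Set (Word n)} {t : Word n}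
    (h : ∀ c ∈ C, c + t ∈ C) : t ∈ codeKernel C := by
  change t +ᵥ C = C
  ext x
  constructor
  · rintro ⟨c, hc, rfl⟩
    have := h c hc
    rwa [add_comm] at this
  · intro hx
    refine ⟨x + t + t, h _ (h _ hx), ?_⟩
    funext i
    have : ∀ a b : ZMod 3, b + (a + b + b) = a := by
      unfold ZMod
      decide
    exact this _ _

/-! ### Partitioning the positions into triples. -/

/-- With `n = 3 * N + 1`, division by three has the same fibre sizes as `g`; the singleton goes to
the last position. -/
lemma exists_perm_div_three {n N : ℕ} (g : Fin n → ℕ) (hle : ∀ i, g i ≤ N)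
    (hlt : ∀ k < N, Nat.card {i // g i = k} = 3) (hN : Nat.card {i // g i = N} = 1) :
    n = 3 * N + 1 ∧ ∃ π : Equiv.Perm (Fin n), ∀ i, (π i : ℕ) / 3 = g i := by
  have hn : n = 3 * N + 1 := by
    have h := Finset.card_eq_sum_card_fiberwise (f := g) (s := Finset.univ)
      (t := Finset.range (N + 1)) (fun i _ => by
        simpa using Nat.lt_succ_of_le (hle i))
    have hcard : ∀ k, (Finset.univ.filter fun i => g i = k).card = Nat.card {i // g i = k} := by
      intro k
      rw [Nat.card_eq_fintype_card, Fintype.card_subtype]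
    simp only [hcard, Finset.card_univ, Fintype.card_fin] at h
    rw [Finset.sum_range_succ, hN,
      Finset.sum_congr rfl fun k hk => hlt k (Finset.mem_range.1 hk)] at h
    simpa [mul_comm] using h
  refine ⟨hn, ?_⟩
  have hfib : ∀ k, Nonempty ({i // g i = k} ≃ {j : Fin n // (j : ℕ) / 3 = k}) := by
    intro k
    rcases lt_trichotomy k N with hk | rfl | hk
    · refine ⟨(Finite.equivFinOfCardEq (hlt k hk)).trans
        (Equiv.ofBijective (fun a => ⟨⟨3 * k + a, by omega⟩, by simp only; omega⟩) ⟨?_, ?_⟩)⟩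
      · intro a b hab
        simp only [Subtype.mk.injEq, Fin.mk.injEq] at hab
        omega
      · rintro ⟨j, hj⟩
        refine ⟨⟨j - 3 * k, by omega⟩, ?_⟩
        ext
        simp only
        omega
    · refine ⟨(Finite.equivFinOfCardEq hN).trans
        (Equiv.ofBijective (fun _ => ⟨⟨3 * k, by omega⟩, by simp⟩) ⟨?_, ?_⟩)⟩
      · intro a b _
        exact Subsingleton.elim a b
      · rintro ⟨j, hj⟩
        refine ⟨0, ?_⟩
        ext
        simp only
        omega
    · have h1 : IsEmpty {i // g i = k} := ⟨fun i => by
        have := hle i.1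
        have := i.2
        omega⟩
      have h2 : IsEmpty {j : Fin n // (j : ℕ) / 3 = k} := ⟨fun j => by
        have := j.1.2
        have := j.2
        omega⟩
      exact ⟨Equiv.equivOfIsEmpty _ _⟩
  have e := fun k => (hfib k).some
  exact ⟨Equiv.ofFiberEquiv e, fun i =>
    Equiv.ofFiberEquiv_map (g := fun j : Fin n => (j : ℕ) / 3) e i⟩

/-- A family of positions with signs such that any nonzero vector has exactly three, and zero one,
signed representations can be partitioned into one singleton and triples of positions that agree
up to sign. -/
lemma exists_triples {ι V : Type*} [Finite ι] [AddCommGroup V] [Module (ZMod 3) V] [Finite V]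
    (col : ι → V)
    (h0 : Nat.card {i // col i = 0} = 1)
    (h3 : ∀ v : V, v ≠ 0 → Nat.card {p : ι × (ZMod 3)ˣ // p.2 • col p.1 = v} = 3) :
    ∃ (N : ℕ) (g : ι → ℕ) (ε : ι → (ZMod 3)ˣ), (∀ i, g i ≤ N) ∧
      (∀ k < N, Nat.card {i // g i = k} = 3) ∧ Nat.card {i // g i = N} = 1 ∧
      ∀ i j, g i = g j → ε i • col i = ε j • col j := by
  classical
  let Q := Quotient (MulAction.orbitRel (ZMod 3)ˣ V)
  let q : V → Q := Quotient.mk _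
  have hq : ∀ v w : V, q v = q w ↔ ∃ u : (ZMod 3)ˣ, u • w = v := fun v w => Quotient.eq
  have hq0 : ∀ v, q v = q 0 ↔ v = 0 := fun v => by
    rw [hq]
    simp [eq_comm]
  -- The signs move every column to the chosen representative of its orbit under `±1`.
  have hε : ∀ i, ∃ u : (ZMod 3)ˣ, u • col i = (q (col i)).out := fun i => by
    rw [← hq]
    exact Quotient.out_eq _
  choose ε hε using hε
  let e := Finite.equivFin {x : Q // x ≠ q 0}
  let N := Nat.card {x : Q // x ≠ q 0}
  -- Nonzero orbits are numbered below `N`; the label `N` is reserved for the zero column.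
  let g : ι → ℕ := fun i => if h : q (col i) ≠ q 0 then e ⟨_, h⟩ else N
  have hgN : ∀ i, g i = N ↔ col i = 0 := by
    intro i
    by_cases h : col i = 0
    · simp [g, h]
    · have h' : q (col i) ≠ q 0 := fun h1 => h ((hq0 _).1 h1)
      simp only [g, dif_pos h', h, iff_false]
      exact (e _).2.ne
  have hgk : ∀ (x : {x : Q // x ≠ q 0}) i, g i = e x ↔ q (col i) = x := by
    intro x i
    by_cases h : q (col i) = q 0
    · simp only [g, h, ne_eq, not_true_eq_false, dif_neg, not_false_eq_true]
      exact iff_of_false (e x).2.ne' x.2.symm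
    · simp only [g, dif_pos (show q (col i) ≠ q 0 from h)]
      rw [Fin.val_inj, e.apply_eq_iff_eq, Subtype.ext_iff]
  refine ⟨N, g, ε, ?_, ?_, ?_, ?_⟩
  · intro i
    by_cases h : q (col i) = q 0
    · simp [g, h]
    · simp only [g, dif_pos (show q (col i) ≠ q 0 from h)]
      exact (e _).2.le
  · intro k hk
    obtain ⟨x, hx⟩ := e.surjective ⟨k, hk⟩
    have hx0 : x.1.out ≠ 0 := by
      intro h
      apply x.2
      have := Quotient.out_eq x.1
      rw [h] at this
      exact this.symm
    rw [← h3 _ hx0]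
    have hxk : (e x : ℕ) = k := by rw [hx]
    refine Nat.card_congr (Equiv.ofBijective (fun i => ⟨(i.1, ε i.1), ?_⟩) ⟨?_, ?_⟩)
    · have hi : q (col i) = x := (hgk x i).1 (i.2.trans hxk.symm)
      simp only [hε, hi]
    · intro i j hij
      exact Subtype.ext (congrArg (fun p => p.1.1) hij)
    · rintro ⟨⟨i, u⟩, hu⟩
      simp only at hu
      have hi : q (col i) = x := by
        rw [← Quotient.out_eq x.1, ← hu]
        exact (hq _ _).2 ⟨u⁻¹, by simp⟩
      refine ⟨⟨i, ((hgk x i).2 hi).trans hxk⟩, ?_⟩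
      have hc : col i ≠ 0 := by
        rintro h
        exact x.2 (by rw [← hi, h])
      have hεu : (ε i : ZMod 3) • col i = (u : ZMod 3) • col i := by
        have : ε i • col i = u • col i := by rw [hε, hi, hu]
        exact this
      have := smul_left_injective (ZMod 3) hc hεu
      simp [Units.ext this]
  · rw [← h0]
    exact Nat.card_congr (Equiv.subtypeEquivRight hgN)
  · intro i j hij
    rw [hε, hε]
    congr 1
    by_cases h : q (col j) = q 0
    · have h1 := (hq0 _).1 h
      rw [(hgN j).2 h1] at hij
      rw [h1, (hgN i).1 hij]
    · have h2 := (hgk ⟨_, h⟩ j).2 rfl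
      exact (hgk ⟨_, h⟩ i).1 (hij.trans h2)

/-- The zero word is one solution and each zero column adds two, one per sign, so `3 = 1 + 2 * k`
forces `k = 1`. -/
lemma exists_unique_zero_column {ι V : Type*} [AddCommGroup V] [Module (ZMod 3) V] (col : ι → V)
    (h : Nat.card {b : Option (ι × (ZMod 3)ˣ) // b.elim 0 (fun p => p.2 • col p.1) = 0} = 3) :
    Nat.card {i // col i = 0} = 1 := by
  have e : {b : Option (ι × (ZMod 3)ˣ) // b.elim 0 (fun p => p.2 • col p.1) = 0} ≃
      Option ({i // col i = 0} × (ZMod 3)ˣ) :=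
    { toFun := fun b => match b with
        | ⟨none, _⟩ => none
        | ⟨some (i, u), h⟩ => some (⟨i, (smul_eq_zero_iff_eq u).1 h⟩, u)
      invFun := fun b => match b with
        | none => ⟨none, rfl⟩
        | some (i, u) => ⟨some (i, u), by simp [i.2]⟩
      left_inv := by rintro ⟨_ | ⟨i, u⟩, h⟩ <;> rfl
      right_inv := by rintro (_ | ⟨i, u⟩) <;> rfl }
  have hfin : Finite (Option ({i // col i = 0} × (ZMod 3)ˣ)) := by
    rw [Nat.card_congr e] at h
    exact Nat.finite_of_card_ne_zero (by omega)
  have : Finite ({i // col i = 0} × (ZMod 3)ˣ) :=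
    Finite.of_injective some (Option.some_injective _)
  have hu : Nat.card (ZMod 3)ˣ = 2 := by
    rw [Nat.card_eq_fintype_card]
    decide
  rw [Nat.card_congr e, Finite.card_option, Nat.card_prod, hu] at h
  omega

lemma card_signed_column {ι V : Type*} [AddCommGroup V] [Module (ZMod 3) V] (col : ι → V)
    {v : V} (hv : v ≠ 0)
    (h : Nat.card {b : Option (ι × (ZMod 3)ˣ) // b.elim 0 (fun p => p.2 • col p.1) = v} = 3) :
    Nat.card {p : ι × (ZMod 3)ˣ // p.2 • col p.1 = v} = 3 := by
  refine Eq.trans ?_ h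
  refine Nat.card_congr (Equiv.ofBijective (fun p => ⟨some p.1, p.2⟩) ⟨?_, ?_⟩)
  · intro p p' hp
    exact Subtype.ext (Option.some_injective _ (congrArg Subtype.val hp))
  · rintro ⟨_ | p, hp⟩
    · exact absurd hp.symm hv
    · exact ⟨⟨p, hp⟩, rfl⟩

/-! ### Kernel words and the final normal form. -/

/-- The positions of a 1-perfect code of rank `+1` can be partitioned into one singleton and
triples that support, with suitable signs, words of the kernel. -/
lemma exists_triples_codeKernel {n : ℕ} {C : Set (Word n)} (hC : IsOnePerfect C)
    (hr : HasRankPlus C 1) :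
    ∃ (N : ℕ) (g : Fin n → ℕ) (ε : Fin n → (ZMod 3)ˣ), (∀ i, g i ≤ N) ∧
      (∀ k < N, Nat.card {i // g i = k} = 3) ∧ Nat.card {i // g i = N} = 1 ∧
      ∀ k < N, (fun i => if g i = k then (ε i : ZMod 3) else 0) ∈ codeKernel C := by
  have hcard := card_errorWord_syndrome hC hr
  set A := affineSpan (ZMod 3) C
  set H := A.direction.mkQ
  have hfin : Finite (Word n ⧸ A.direction) := Finite.of_surjective _ A.direction.mkQ_surjective
  let col : Fin n → Word n ⧸ A.direction := fun i => H (Pi.single i 1)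
  have hcol : ∀ p : Fin n × (ZMod 3)ˣ, H (errorWord (some p)) = p.2 • col p.1 := by
    rintro ⟨i, u⟩
    change H (Pi.single i (u : ZMod 3)) = (u : ZMod 3) • H (Pi.single i 1)
    rw [← map_smul, ← Pi.single_smul, smul_eq_mul, mul_one]
  have hH : ∀ b : Option (Fin n × (ZMod 3)ˣ),
      H (errorWord b) = b.elim 0 (fun p => p.2 • col p.1) := by
    rintro (_ | p)
    · exact map_zero H
    · exact hcol p
  simp only [hH] at hcard
  have h0 := exists_unique_zero_column col (hcard 0)
  obtain ⟨N, g, ε, hle, hlt, hN, heq⟩ :=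
    exists_triples col h0 fun v hv => card_signed_column col hv (hcard v)
  refine ⟨N, g, ε, hle, hlt, hN, fun k hk => mem_codeKernel_of_forall fun c hc => ?_⟩
  obtain ⟨i₀, hi₀⟩ := Nat.card_eq_one_iff_exists.1 h0
  have hA : C ⊆ A := subset_affineSpan _ _
  have he : ∀ w ∈ A, ∃ y : ZMod 3, w + Pi.single i₀.1 y ∈ C := by
    intro w hw
    obtain ⟨⟨⟨d, hd⟩, b⟩, rfl⟩ := hC.bijective.2 w
    -- Both `w` and its codeword lie in `A`, so the error has syndrome zero and sits at `i₀`.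
    have hb : H (errorWord b) = 0 := by
      refine (Submodule.Quotient.mk_eq_zero _).2 ?_
      simpa using AffineSubspace.vsub_mem_direction hw (hA hd)
    rcases b with _ | ⟨i, u⟩
    · exact ⟨0, by simpa [errorWord] using hd⟩
    · rw [hcol, smul_eq_zero_iff_eq] at hb
      obtain rfl := hi₀ ⟨i, hb⟩
      exact ⟨-u, by simpa [errorWord, add_assoc, ← Pi.single_add] using hd⟩
  let f := (Finite.equivFinOfCardEq (hlt k hk)).symm
  have hp : Function.Injective (fun a => ((f a).1, ε (f a).1)) := fun a b hab =>
    f.injective (Subtype.ext (congrArg Prod.fst hab))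
  have hmem := add_mem_of_three hC hA he hp (fun a b => by
    refine (Submodule.Quotient.eq _).1 ?_
    change H _ = H _
    rw [hcol, hcol]
    exact heq _ _ ((f a).2.trans (f b).2.symm)) hc
  convert hmem using 2
  funext j
  rw [Finset.sum_apply]
  by_cases hj : g j = k
  · obtain ⟨a, ha⟩ := f.surjective ⟨j, hj⟩
    rw [if_pos hj, Finset.sum_eq_single a]
    · simp [errorWord, ha]
    · intro b _ hb
      have : j ≠ (f b).1 := fun h => hb (f.injective (by rw [ha]; exact Subtype.ext h.symm))
      simp [errorWord, this]
    · simp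
  · rw [if_neg hj, Finset.sum_eq_zero]
    intro b _
    have : j ≠ (f b).1 := fun h => hj (by rw [h]; exact (f b).2)
    simp [errorWord, this]

end TernaryPerfect

theorem corollary3p1 (n : ℕ) (C : Set (TernaryPerfect.Word n))
    (hC : TernaryPerfect.IsOnePerfect C) (hr : TernaryPerfect.HasRankPlus C 1) :
    ((n : ℚ) - 1) / 3 ≤ (Module.finrank (ZMod 3) (TernaryPerfect.codeKernel C) : ℚ) ∧
    ∃ (π : Equiv.Perm (Fin n)) (ε : Fin n → (ZMod 3)ˣ),
      ∀ j : ℕ, j < (n - 1) / 3 →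
        TernaryPerfect.tripleWord n j ∈
          TernaryPerfect.codeKernel (TernaryPerfect.monomialMap π ε '' C) := by
  obtain ⟨N, g, ε, hle, hlt, hN, hker⟩ := TernaryPerfect.exists_triples_codeKernel hC hr
  obtain ⟨hn, π, hπ⟩ := TernaryPerfect.exists_perm_div_three g hle hlt hN
  have hunit : ∀ u : (ZMod 3)ˣ, (u : ZMod 3) * u = 1 := by decide
  constructor
  · have hli : LinearIndependent (ZMod 3) (fun k : Fin N =>
        (⟨_, hker k k.2⟩ : TernaryPerfect.codeKernel C)) := by
      rw [Fintype.linearIndependent_iff]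
      intro a ha k
      have hk := hlt k k.2
      obtain ⟨⟨i, hi⟩⟩ := (Nat.card_pos_iff.1 (by omega : 0 < Nat.card {i // g i = k})).1
      have := congrFun (congrArg Subtype.val ha) i
      simpa [hi, Fin.val_inj] using this
    have h := hli.fintype_card_le_finrank
    rw [Fintype.card_fin] at h
    have h' : (N : ℚ) ≤ Module.finrank (ZMod 3) (TernaryPerfect.codeKernel C) := by
      exact_mod_cast h
    have hn' : (n : ℚ) = 3 * N + 1 := by exact_mod_cast hn
    linarith
  -- Scalars are applied after the permutation, hence the reindexing; each sign squares to one, so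
  -- the kernel words become 0-1 words.
  · refine ⟨π, fun i => ε (π.symm i), fun j hj => ?_⟩
    have hj' : j < N := by omega
    refine TernaryPerfect.mem_codeKernel_of_forall ?_
    rintro _ ⟨c, hc, rfl⟩
    have hmem := hker j hj'
    change _ +ᵥ C = C at hmem
    refine ⟨(fun i => if g i = j then (ε i : ZMod 3) else 0) + c, ?_, ?_⟩
    · exact hmem.subset (Set.vadd_mem_vadd_set hc)
    · funext i
      have hi : (i : ℕ) / 3 = g (π.symm i) := by rw [← hπ, Equiv.apply_symm_apply]
      by_cases h : g (π.symm i) = j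
      · simp [TernaryPerfect.monomialMap, TernaryPerfect.tripleWord, hi, h, mul_add, hunit,
          add_comm]
      · simp [TernaryPerfect.monomialMap, TernaryPerfect.tripleWord, hi, h]
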